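/- Let $T$ be a first-order theory in a language $\mathcal{L}$ expanding a group, and let $\mathcal{G}$ be a $\kappa$-saturated model of $T$, where $\kappa > |\mathcal{L}| + \aleph_0$; "small" means of cardinality $< \kappa$. (If $T$ has other sorts, $\mathcal G$ also denotes the ($\emptyset$-definable) sort carrying the group; elements multiplied and the variables $x,y$ belong to that sort, parameters may be arbitrary.) A Keisler measure over a set $A$ is a finitely additive probability measure on the Boolean algebra of $A$-definable subsets of the group; it is identified with the corresponding regular Borel probability measure on the type space $S_x(A)$. Its support is $S(\mu)=\{p\in S_x(A) : \mu(\varphi)>0 \text{ for all } \varphi\in p\}$, and $\mu|_B$ denotes its restriction to $B \subseteq A$. Let $\mu$ be a global Keisler measure (over $\mathcal{G}$). - $\mu$ is *definable over* $N\prec\mathcal{G}$ if for every $\mathcal{L}(N)$-formula $\varphi(x;\bar y)$ the value $\mu(\varphi(x;\bar b))$ depends only on $\operatorname{tp}(\bar b/N)$ and is a continuous function of it on $S_{\bar y}(N)$; $\mu$ is *definable* if it is definable over some small $N \prec \mathcal{G}$. - $\mu$ is *invariantly supported* if there is a small $N\prec\mathcal{G}$ such that every $p\in S(\mu)$ is $N$-invariant.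 - $\mu$ is *idempotent* if the following holds. For every formula $\varphi(x)$ over $\mathcal{G}$ there is a small $N\prec\mathcal{G}$ containing the parameters of $\varphi$ such that for each $q\in S(\mu|_N)$ the value $F(q):=\mu(\varphi(x\cdot d))$ is the same for all $d\models q$, and $F$ is Borel on $S(\mu|_N)$; and $(\mu*\mu)(\varphi):=\int_{S(\mu|_N)}F\,d(\mu|_N)$ (for some/any such $N$) equals $\mu(\varphi)$. - For global types $p,q$ with $p$ invariant, $p*q$ is the type of $a\cdot b$ where $(a,b)\models p\otimes q$; that is, $\varphi(x)\in p*q$ if and only if $\varphi(x\cdot b)\in p$ for some/any $b\models q|_N$, where $N \prec \mathcal{G}$ is small, contains the parameters of $\varphi$, and $p$ is $N$-invariant. - A definable, invariantly supported, idempotent $\mu$ is *minimal* if $S(\mu)$ is a minimal left ideal of the semigroup $(S(\mu),*)$. - For definable $\mu$ and a formula $\varphi(x)$ over $\mathcal{G}$, $D_\mu^{\varphi'}(p):=\mu(\varphi(x\cdot c))$ for some/any $c\models p|_N$, where $N\prec\mathcal{G}$ is small, contains the parameters of $\varphi$, and $\mu$ is definable over $N$. Suppose $\mu$ is definable, invariantly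 supported, idempotent and minimal. Then: 1. For every formula $\varphi(x)$ over $\mathcal{G}$, the function $D_\mu^{\varphi'}$ is constant on $S(\mu)$, with value $\mu(\varphi(x))$. 2. Let $G\prec\mathcal{G}$ be a small model over which $\mu$ is definable, let $\bar b$ be a finite tuple from $\mathcal{G}$, and let $\varphi(x)=\varphi(x;\bar b)$ be a formula with parameters from $G\bar b$. Then for every group element $a$ with $\operatorname{tp}(a/G\bar b)\in S(\mu|_{G\bar b})$ we have $\mu(\varphi(x))=\mu(\varphi(x\cdot a))$. -/

import Mathlib

open FirstOrder FirstOrder.Language Set MeasureTheory TopologicalSpace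
open scoped NNReal ENNReal Cardinal

universe u v w

noncomputable section

namespace Keisler

variable (L : FirstOrder.Language.{u, v}) (U : Type w) [L.Structure U]

/-- The space `S_n(A)` of complete `n`-types over the parameter set `A ⊆ U`
(with the topology that Mathlib puts on it: the sets `[φ]` are basic open). -/
abbrev TypeSpace (A : Set U) (n : ℕ) : Type _ :=
  (L[[A]].completeTheory U).CompleteType (Fin n)

instance (A : Set U) (n : ℕ) : MeasurableSpace (TypeSpace L U A n) := borel _

instance (A : Set U) (n : ℕ) : BorelSpace (TypeSpace L U A n) := ⟨rfl⟩

variable {L U}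

/-- `tp(v/A)`. -/
def tp (L : FirstOrder.Language.{u, v}) {U : Type w} [L.Structure U] [Nonempty U]
    (A : Set U) {n : ℕ} (v : Fin n → U) : TypeSpace L U A n :=
  (L[[A]].completeTheory U).typeOf v

/-- The type `p ∈ S_n(A)` contains the formulas over `A` that define the set `X`. -/
def Contains {A : Set U} {n : ℕ} (p : TypeSpace L U A n) (X : L.DefinableSet A (Fin n)) : Prop :=
  ∃ φ : L[[A]].Formula (Fin n), (X : Set (Fin n → U)) = {v | φ.Realize v} ∧
    Formula.equivSentence φ ∈ p

/-- The clopen set `[X]` of types that contain `X`. -/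
def basicClopen {A : Set U} {n : ℕ} (X : L.DefinableSet A (Fin n)) : Set (TypeSpace L U A n) :=
  {p | Contains p X}

section TypeFacts

variable {A : Set U} {n : ℕ}

theorem mem_of_realize_imp [Nonempty U] (p : TypeSpace L U A n) {φ ψ : L[[A]].Formula (Fin n)}
    (h : ∀ v : Fin n → U, φ.Realize v → ψ.Realize v) (hφ : Formula.equivSentence φ ∈ p) :
    Formula.equivSentence ψ ∈ p := by
  have key : (L[[A]].completeTheory U) ⊨ᵇ Formula.iAlls (Fin n)
      ((φ.imp ψ).relabel (Sum.inr : Fin n → Empty ⊕ Fin n)) := by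
    have hc := completeTheory.isComplete L[[A]] U
    rw [← hc.realize_sentence_iff _ U]
    unfold Sentence.Realize
    rw [Formula.realize_iAlls]
    intro w
    have : (φ.imp ψ).Realize w := by
      rw [Formula.realize_imp]
      exact h w
    simpa [Formula.realize_relabel, Function.comp_def] using this
  obtain ⟨M, v, rfl⟩ := Theory.exists_modelType_is_realized_in _ p
  rw [Theory.CompleteType.formula_mem_typeOf] at hφ ⊢
  have h1 := key.realize_sentence M
  unfold Sentence.Realize at h1
  rw [Formula.realize_iAlls] at h1
  have h2 := h1 v
  simp only [Formula.realize_relabel, Function.comp_def, Sum.elim_inr,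
    Formula.realize_imp] at h2
  exact h2 hφ

theorem contains_of_realize [Nonempty U] {p : TypeSpace L U A n} {X : L.DefinableSet A (Fin n)}
    {φ : L[[A]].Formula (Fin n)} (h : (X : Set (Fin n → U)) = {v | φ.Realize v}) :
    Contains p X ↔ Formula.equivSentence φ ∈ p := by
  refine ⟨fun ⟨ψ, hψ, hp⟩ => mem_of_realize_imp p (fun v hv => ?_) hp, fun hp => ⟨φ, h, hp⟩⟩
  have : v ∈ (X : Set (Fin n → U)) := by rw [hψ]; exact hv
  rw [h] at this
  exact this

theorem exists_formula (X : L.DefinableSet A (Fin n)) :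
    ∃ φ : L[[A]].Formula (Fin n), (X : Set (Fin n → U)) = {v | φ.Realize v} := X.2

theorem contains_inf [Nonempty U] {p : TypeSpace L U A n} {X Y : L.DefinableSet A (Fin n)} :
    Contains p (X ⊓ Y) ↔ Contains p X ∧ Contains p Y := by
  obtain ⟨φ, hφ⟩ := exists_formula X
  obtain ⟨ψ, hψ⟩ := exists_formula Y
  have hi : ((X ⊓ Y : L.DefinableSet A (Fin n)) : Set (Fin n → U)) = {v | (φ ⊓ ψ).Realize v} := by
    rw [DefinableSet.coe_inf, hφ, hψ]
    ext v
    simp [Formula.realize_inf]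
  rw [contains_of_realize hφ, contains_of_realize hψ, contains_of_realize hi]
  obtain ⟨M, v, rfl⟩ := Theory.exists_modelType_is_realized_in _ p
  simp only [Theory.CompleteType.formula_mem_typeOf, Formula.realize_inf]

theorem contains_compl [Nonempty U] {p : TypeSpace L U A n} {X : L.DefinableSet A (Fin n)} :
    Contains p Xᶜ ↔ ¬ Contains p X := by
  obtain ⟨φ, hφ⟩ := exists_formula X
  have hi : ((Xᶜ : L.DefinableSet A (Fin n)) : Set (Fin n → U)) = {v | φ.not.Realize v} := by
    rw [DefinableSet.coe_compl, hφ]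
    ext v
    simp [Formula.realize_not]
  rw [contains_of_realize hφ, contains_of_realize hi]
  obtain ⟨M, v, rfl⟩ := Theory.exists_modelType_is_realized_in _ p
  simp only [Theory.CompleteType.formula_mem_typeOf, Formula.realize_not]

theorem contains_tp [Nonempty U] {v : Fin n → U} {X : L.DefinableSet A (Fin n)} :
    Contains (tp L A v) X ↔ v ∈ X := by
  obtain ⟨φ, hφ⟩ := exists_formula X
  rw [contains_of_realize hφ, tp, Theory.CompleteType.formula_mem_typeOf, ← SetLike.mem_coe, hφ]
  rfl

theorem contains_sup [Nonempty U] {p : TypeSpace L U A n} {X Y : L.DefinableSet A (Fin n)} :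
    Contains p (X ⊔ Y) ↔ Contains p X ∨ Contains p Y := by
  rw [← not_iff_not, ← contains_compl, compl_sup, contains_inf, contains_compl, contains_compl,
    not_or]

theorem contains_top [Nonempty U] (p : TypeSpace L U A n) :
    Contains p (⊤ : L.DefinableSet A (Fin n)) := by
  have h : Contains p ((⊤ : L.DefinableSet A (Fin n)) ⊔ (⊤ : L.DefinableSet A (Fin n))ᶜ) := by
    rw [contains_sup, contains_compl]
    exact em _
  rwa [sup_compl_eq_top] at h

/-- Definable sets correspond exactly to Mathlib's basic open sets of types. -/
theorem exists_basicClopen_eq [Nonempty U] (σ : L[[A]][[Fin n]].Sentence) :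
    ∃ X : L.DefinableSet A (Fin n),
      basicClopen X = (L[[A]].completeTheory U).typesWith σ := by
  obtain ⟨φ, rfl⟩ := Formula.equivSentence.surjective σ
  refine ⟨⟨{v | φ.Realize v}, φ, rfl⟩, ?_⟩
  ext p
  exact contains_of_realize rfl

theorem isClopen_basicClopen [Nonempty U] (X : L.DefinableSet A (Fin n)) :
    IsClopen (basicClopen X) := by
  obtain ⟨φ, hφ⟩ := exists_formula X
  have : basicClopen X = (L[[A]].completeTheory U).typesWith (Formula.equivSentence φ) := by
    ext p
    exact contains_of_realize hφ
  rw [this]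
  exact CompleteType.isClopen_typesWith _

theorem exists_basicClopen_between [Nonempty U] {K V : Set (TypeSpace L U A n)}
    (hK : IsCompact K) (hV : IsOpen V) (hKV : K ⊆ V) :
    ∃ X : L.DefinableSet A (Fin n), K ⊆ basicClopen X ∧ basicClopen X ⊆ V := by
  refine hK.induction_on
    (p := fun s => ∃ X : L.DefinableSet A (Fin n), s ⊆ basicClopen X ∧ basicClopen X ⊆ V)
    ⟨⊥, empty_subset _, ?_⟩ ?_ ?_ ?_
  · intro p hp
    have h1 : Contains p (⊤ᶜ : L.DefinableSet A (Fin n)) := by rw [compl_top]; exact hp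
    exact absurd (contains_top p) (contains_compl.1 h1)
  · rintro s t hst ⟨X, h1, h2⟩
    exact ⟨X, hst.trans h1, h2⟩
  · rintro s t ⟨X, h1, h2⟩ ⟨Y, h3, h4⟩
    refine ⟨X ⊔ Y, ?_, ?_⟩
    · rintro p (hp | hp)
      · exact contains_sup.2 (Or.inl (h1 hp))
      · exact contains_sup.2 (Or.inr (h3 hp))
    · intro p hp
      rcases contains_sup.1 hp with h | h
      · exact h2 h
      · exact h4 h
  · intro p hp
    obtain ⟨_, ⟨σ, rfl⟩, hpσ, hσ⟩ :=
      CompleteType.isTopologicalBasis_range_typesWith.exists_subset_of_mem_open (hKV hp) hV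
    obtain ⟨X, hX⟩ := exists_basicClopen_eq (U := U) σ
    refine ⟨basicClopen X, mem_nhdsWithin_of_mem_nhds
      ((isClopen_basicClopen X).isOpen.mem_nhds (by rw [hX]; exact hpσ)), X, subset_rfl, ?_⟩
    rw [hX]
    exact hσ

theorem le_of_basicClopen_subset [Nonempty U] {X Y : L.DefinableSet A (Fin n)}
    (h : basicClopen X ⊆ basicClopen Y) : X ≤ Y := fun v hv =>
  contains_tp.1 (h (contains_tp.2 hv : tp L A v ∈ basicClopen X))

end TypeFacts

variable (L U) in
/-- A Keisler measure over `A` in `n` variables: a finitely additive probability measure on the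
Boolean algebra of `A`-definable subsets of `Uⁿ`. It is global when `A = univ`. -/
structure KeislerMeasure (A : Set U) (n : ℕ) where
  toFun : L.DefinableSet A (Fin n) → ℝ
  nonneg : ∀ X, 0 ≤ toFun X
  top : toFun ⊤ = 1
  sup_of_disjoint : ∀ X Y, Disjoint X Y → toFun (X ⊔ Y) = toFun X + toFun Y

instance {A : Set U} {n : ℕ} :
    CoeFun (KeislerMeasure L U A n) fun _ => L.DefinableSet A (Fin n) → ℝ :=
  ⟨KeislerMeasure.toFun⟩

/-- An `A`-definable set, viewed as a `B`-definable set for `B ⊇ A`. -/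
def weaken {A B : Set U} {α : Type*} (h : A ⊆ B) (X : L.DefinableSet A α) : L.DefinableSet B α :=
  ⟨X, X.2.mono h⟩

namespace KeislerMeasure

variable {A : Set U} {n : ℕ}

/-- The restriction `μ|_A` of a global measure. -/
def restrict (μ : KeislerMeasure L U univ n) (A : Set U) : KeislerMeasure L U A n where
  toFun X := μ (weaken (subset_univ A) X)
  nonneg X := μ.nonneg _
  top := μ.top
  sup_of_disjoint X Y h := μ.sup_of_disjoint (weaken _ X) (weaken _ Y) <| by
    rw [disjoint_iff_inf_le] at h ⊢
    intro v hv
    exact h (show v ∈ X ⊓ Y from hv)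

/-- The support `S(μ)`. -/
def support (μ : KeislerMeasure L U A n) : Set (TypeSpace L U A n) :=
  {p | ∀ X, Contains p X → 0 < μ X}

theorem mono (μ : KeislerMeasure L U A n) {X Y : L.DefinableSet A (Fin n)} (h : X ≤ Y) :
    μ X ≤ μ Y := by
  have h1 := μ.sup_of_disjoint X (Y \ X) disjoint_sdiff_self_right
  rw [sup_sdiff_cancel_right h] at h1
  have h2 := μ.nonneg (Y \ X)
  linarith

theorem sup_le (μ : KeislerMeasure L U A n) (X Y : L.DefinableSet A (Fin n)) :
    μ (X ⊔ Y) ≤ μ X + μ Y := by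
  have h1 := μ.sup_of_disjoint X (Y \ X) disjoint_sdiff_self_right
  rw [sup_sdiff_self_right] at h1
  have h2 := μ.mono (sdiff_le : Y \ X ≤ Y)
  linarith

/-- `K ↦ inf {μ(X) : K ⊆ [X]}` on compact sets of types. -/
def outerValue (μ : KeislerMeasure L U A n) (K : Set (TypeSpace L U A n)) : ℝ :=
  sInf {r | ∃ X, K ⊆ basicClopen X ∧ r = μ X}

theorem bddBelow_outer (μ : KeislerMeasure L U A n) (K : Set (TypeSpace L U A n)) :
    BddBelow {r | ∃ X, K ⊆ basicClopen X ∧ r = μ X} :=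
  ⟨0, by rintro _ ⟨X, -, rfl⟩; exact μ.nonneg X⟩

theorem nonempty_outer [Nonempty U] (μ : KeislerMeasure L U A n) (K : Set (TypeSpace L U A n)) :
    {r | ∃ X, K ⊆ basicClopen X ∧ r = μ X}.Nonempty :=
  ⟨_, ⊤, fun p _ => contains_top p, rfl⟩

theorem outerValue_nonneg (μ : KeislerMeasure L U A n) (K : Set (TypeSpace L U A n)) :
    0 ≤ μ.outerValue K :=
  Real.sInf_nonneg (by rintro _ ⟨X, -, rfl⟩; exact μ.nonneg X)

theorem outerValue_le (μ : KeislerMeasure L U A n) {K : Set (TypeSpace L U A n)}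
    {X : L.DefinableSet A (Fin n)} (h : K ⊆ basicClopen X) : μ.outerValue K ≤ μ X :=
  csInf_le (μ.bddBelow_outer K) ⟨X, h, rfl⟩

theorem le_outerValue [Nonempty U] (μ : KeislerMeasure L U A n) {K : Set (TypeSpace L U A n)}
    {r : ℝ} (h : ∀ X, K ⊆ basicClopen X → r ≤ μ X) : r ≤ μ.outerValue K :=
  le_csInf (μ.nonempty_outer K) (by rintro _ ⟨X, hX, rfl⟩; exact h X hX)

theorem outerValue_sup_le [Nonempty U] (μ : KeislerMeasure L U A n)
    (K₁ K₂ : Set (TypeSpace L U A n)) :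
    μ.outerValue (K₁ ∪ K₂) ≤ μ.outerValue K₁ + μ.outerValue K₂ := by
  rw [← sub_le_iff_le_add]
  refine μ.le_outerValue fun X hX => ?_
  rw [sub_le_comm]
  refine μ.le_outerValue fun Y hY => ?_
  rw [sub_le_iff_le_add']
  refine (μ.outerValue_le (X := X ⊔ Y) ?_).trans (μ.sup_le X Y)
  rintro p (hp | hp)
  · exact contains_sup.2 (Or.inl (hX hp))
  · exact contains_sup.2 (Or.inr (hY hp))

theorem outerValue_sup_of_disjoint [Nonempty U] (μ : KeislerMeasure L U A n)
    {K₁ K₂ : Set (TypeSpace L U A n)} (hK₁ : IsCompact K₁) (hK₂ : IsClosed K₂)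
    (hd : Disjoint K₁ K₂) :
    μ.outerValue (K₁ ∪ K₂) = μ.outerValue K₁ + μ.outerValue K₂ := by
  refine le_antisymm (μ.outerValue_sup_le K₁ K₂) (μ.le_outerValue fun Z hZ => ?_)
  obtain ⟨X, h1, h2⟩ := exists_basicClopen_between hK₁ hK₂.isOpen_compl hd.subset_compl_right
  have hsplit : μ Z = μ (Z ⊓ X) + μ (Z ⊓ Xᶜ) := by
    rw [← μ.sup_of_disjoint, ← inf_sup_left, sup_compl_eq_top, inf_top_eq]
    exact disjoint_compl_right.mono inf_le_right inf_le_right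
  rw [hsplit]
  refine add_le_add (μ.outerValue_le fun p hp => ?_) (μ.outerValue_le fun p hp => ?_)
  · exact contains_inf.2 ⟨hZ (Or.inl hp), h1 hp⟩
  · exact contains_inf.2 ⟨hZ (Or.inr hp), contains_compl.2 fun h => h2 h hp⟩

/-- The content on `S_n(A)` induced by a Keisler measure. -/
def content [Nonempty U] (μ : KeislerMeasure L U A n) : Content (TypeSpace L U A n) where
  toFun K := ⟨μ.outerValue K, μ.outerValue_nonneg _⟩
  mono' K₁ K₂ h := NNReal.coe_le_coe.1 <|
    μ.le_outerValue fun _ hX => μ.outerValue_le (h.trans hX)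
  sup_disjoint' K₁ K₂ hd _ h₂ := NNReal.coe_injective <| by
    change μ.outerValue _ = μ.outerValue _ + μ.outerValue _
    rw [Compacts.coe_sup]
    exact μ.outerValue_sup_of_disjoint K₁.isCompact h₂ hd
  sup_le' K₁ K₂ := NNReal.coe_le_coe.1 <| by
    change μ.outerValue _ ≤ μ.outerValue _ + μ.outerValue _
    rw [Compacts.coe_sup]
    exact μ.outerValue_sup_le (K₁ : Set (TypeSpace L U A n)) K₂

/-- The regular Borel probability measure on `S_n(A)` that corresponds to a Keisler measure. -/
def borelMeasure [Nonempty U] (μ : KeislerMeasure L U A n) : Measure (TypeSpace L U A n) :=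
  μ.content.measure

theorem borelMeasure_basicClopen [Nonempty U] (μ : KeislerMeasure L U A n)
    (X : L.DefinableSet A (Fin n)) :
    μ.borelMeasure (basicClopen X) = ENNReal.ofReal (μ X) := by
  have hX := isClopen_basicClopen X
  have hc : IsCompact (basicClopen X) := hX.isClosed.isCompact
  have hv : μ.outerValue (basicClopen X) = μ X :=
    le_antisymm (μ.outerValue_le subset_rfl)
      (μ.le_outerValue fun Y hY => μ.mono (le_of_basicClopen_subset hY))
  rw [borelMeasure, Content.measure_apply _ hX.isOpen.measurableSet,
    Content.outerMeasure_of_isOpen _ _ hX.isOpen, Content.innerContent_of_isCompact _ hc hX.isOpen,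
    ENNReal.ofReal, ← hv]
  change ENNReal.ofNNReal ⟨μ.outerValue _, μ.outerValue_nonneg _⟩ = _
  congr 1
  exact (Real.toNNReal_of_nonneg (μ.outerValue_nonneg _)).symm

instance [Nonempty U] (μ : KeislerMeasure L U A n) : μ.borelMeasure.Regular :=
  inferInstanceAs μ.content.measure.Regular

instance [Nonempty U] (μ : KeislerMeasure L U A n) : IsProbabilityMeasure μ.borelMeasure := ⟨by
  have h : basicClopen (⊤ : L.DefinableSet A (Fin n)) = univ :=
    eq_univ_of_forall contains_top
  rw [← h, borelMeasure_basicClopen, μ.top, ENNReal.ofReal_one]⟩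

end KeislerMeasure

/-- The instance `R(x; b)` of a partitioned formula `R(x; y)` over `A`, where `x` is a single
variable and `y` an `n`-tuple of variables. -/
def fiber {A : Set U} {n : ℕ} (R : L.DefinableSet A (Fin 1 ⊕ Fin n)) (b : Fin n → U) :
    L.DefinableSet (univ : Set U) (Fin 1) :=
  ⟨{x | Sum.elim x b ∈ R}, by
    have hR : (univ : Set U).Definable L (R : Set (Fin 1 ⊕ Fin n → U)) := R.2.mono (subset_univ A)
    refine hR.preimage_map (F := fun x => Sum.elim x b) ?_
    rintro (i | j)
    · exact (definableFun_var (L := L) i).mono (empty_subset _)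
    · exact definableFun_const L _ (mem_univ _)⟩

/-- `U` is `κ`-saturated. -/
def IsSaturated (L : FirstOrder.Language.{u, v}) (U : Type w) [L.Structure U] [Nonempty U]
    (κ : Cardinal.{w}) : Prop :=
  ∀ A : Set U, #A < κ → ∀ (n : ℕ) (p : TypeSpace L U A n), ∃ v : Fin n → U, tp L A v = p

variable [Nonempty U]

/-- `v ⊨ p|_A` for a global type `p`. -/
def RealizesRestriction {n : ℕ} (v : Fin n → U) (p : TypeSpace L U univ n) (A : Set U) : Prop :=
  ∀ X : L.DefinableSet A (Fin n), v ∈ X ↔ Contains p (weaken (subset_univ A) X)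

/-- The global type `p` is invariant over `N`. -/
def IsInvariantType (p : TypeSpace L U univ 1) (N : L.ElementarySubstructure U) : Prop :=
  ∀ (n : ℕ) (R : L.DefinableSet (N : Set U) (Fin 1 ⊕ Fin n)) (b b' : Fin n → U),
    tp L (N : Set U) b = tp L (N : Set U) b' → (Contains p (fiber R b) ↔ Contains p (fiber R b'))

namespace KeislerMeasure

/-- The global measure `μ` is invariant over `N`. -/
def IsInvariantOver (μ : KeislerMeasure L U univ 1) (N : L.ElementarySubstructure U) : Prop :=
  ∀ (n : ℕ) (R : L.DefinableSet (N : Set U) (Fin 1 ⊕ Fin n)) (b b' : Fin n → U),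
    tp L (N : Set U) b = tp L (N : Set U) b' → μ (fiber R b) = μ (fiber R b')

open Classical in
/-- The map `q ↦ μ(R(x; b))`, `b ⊨ q`, on `S_n(A)` (with value `0` if no tuple of `U` realizes
`q`, which does not occur for `A` small and `U` saturated). -/
def fiberMap (μ : KeislerMeasure L U univ 1) (A : Set U) {B : Set U} {n : ℕ}
    (R : L.DefinableSet B (Fin 1 ⊕ Fin n)) (q : TypeSpace L U A n) : ℝ :=
  if h : ∃ b : Fin n → U, tp L A b = q then μ (fiber R h.choose) else 0

/-- The global measure `μ` is definable over `N`. -/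
def IsDefinableOver (μ : KeislerMeasure L U univ 1) (N : L.ElementarySubstructure U) : Prop :=
  μ.IsInvariantOver N ∧ ∀ (n : ℕ) (R : L.DefinableSet (N : Set U) (Fin 1 ⊕ Fin n)),
    Continuous (μ.fiberMap (N : Set U) R)

/-- `μ` is definable: definable over some small `N ≺ U`. Small means of cardinality `< κ`. -/
def IsDefinable (κ : Cardinal.{w}) (μ : KeislerMeasure L U univ 1) : Prop :=
  ∃ N : L.ElementarySubstructure U, #N < κ ∧ μ.IsDefinableOver N

/-- `μ` is invariantly supported: all types in its support are invariant over one small `N ≺ U`. -/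
def IsInvariantlySupported (κ : Cardinal.{w}) (μ : KeislerMeasure L U univ 1) : Prop :=
  ∃ N : L.ElementarySubstructure U, #N < κ ∧ ∀ p ∈ μ.support, IsInvariantType p N

/-- The small model `N` witnesses that the triple `(μ, ν, R(x, y))` is Borel. -/
structure BorelWitness (κ : Cardinal.{w}) (μ ν : KeislerMeasure L U univ 1)
    (R : L.DefinableSet (univ : Set U) (Fin 1 ⊕ Fin 1)) (N : L.ElementarySubstructure U) :
    Prop where
  small : #N < κ
  params : (N : Set U).Definable L (R : Set (Fin 1 ⊕ Fin 1 → U))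
  wellDefined : ∀ q ∈ (ν.restrict (N : Set U)).support, ∀ d d' : Fin 1 → U,
    tp L (N : Set U) d = q → tp L (N : Set U) d' = q → μ (fiber R d) = μ (fiber R d')
  measurable : Measurable fun q : (ν.restrict (N : Set U)).support =>
    μ.fiberMap (N : Set U) R q

open Classical in
/-- The value `(μ ⊗ ν)(R(x, y))`: the integral over `S(ν|_N)` of `q ↦ μ(R(x, d))`, `d ⊨ q`, with
respect to the Borel measure of `ν|_N`, where `N` is a small model witnessing that `(μ, ν, R)` is
Borel (and `0` if there is none). -/
def productValue (κ : Cardinal.{w}) (μ ν : KeislerMeasure L U univ 1)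
    (R : L.DefinableSet (univ : Set U) (Fin 1 ⊕ Fin 1)) : ℝ :=
  if h : ∃ N, BorelWitness κ μ ν R N then
    ∫ q in (ν.restrict (h.choose : Set U)).support, μ.fiberMap (h.choose : Set U) R q
      ∂(ν.restrict (h.choose : Set U)).borelMeasure
  else 0

end KeislerMeasure

variable (L U) in
/-- A group `∅`-definable in `U`. If `U` itself expands a group, the carrier is all of `U`; in
general the carrier is the sort (or definable set) on which the group lives. -/
structure DefinableGroup where
  carrier : Set U
  [group : Group carrier]
  definable_carrier : (∅ : Set U).Definable L {v : Fin 1 → U | v 0 ∈ carrier}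
  definable_mul : (∅ : Set U).Definable L {v : Fin 3 → U |
    ∃ (h₀ : v 0 ∈ carrier) (h₁ : v 1 ∈ carrier),
      ((⟨v 0, h₀⟩ * ⟨v 1, h₁⟩ : carrier) : U) = v 2}

attribute [instance] DefinableGroup.group

namespace DefinableGroup

variable (G : DefinableGroup L U)

/-- The group's carrier as a global definable set. -/
def carrierSet : L.DefinableSet (univ : Set U) (Fin 1) :=
  ⟨{v | v 0 ∈ G.carrier}, G.definable_carrier.mono (empty_subset _)⟩

/-- `φ'(x, y) := φ(x · y)` -/
def shift {A : Set U} (X : L.DefinableSet A (Fin 1)) : L.DefinableSet A (Fin 1 ⊕ Fin 1) :=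
  ⟨{w | ∃ (h₀ : w (Sum.inl 0) ∈ G.carrier) (h₁ : w (Sum.inr 0) ∈ G.carrier),
      (fun _ => ((⟨_, h₀⟩ * ⟨_, h₁⟩ : G.carrier) : U)) ∈ X}, by
    have h1 : A.Definable L {w : (Fin 1 ⊕ Fin 1) ⊕ Fin 1 → U |
        (∃ (h₀ : w (Sum.inl (Sum.inl 0)) ∈ G.carrier) (h₁ : w (Sum.inl (Sum.inr 0)) ∈ G.carrier),
          ((⟨_, h₀⟩ * ⟨_, h₁⟩ : G.carrier) : U) = w (Sum.inr 0)) ∧ (fun i => w (Sum.inr i)) ∈ X} :=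
      ((G.definable_mul.mono (empty_subset A)).preimage_comp
        ![Sum.inl (Sum.inl 0), Sum.inl (Sum.inr 0), Sum.inr 0]).inter
        (X.2.preimage_comp (Sum.inr : Fin 1 → (Fin 1 ⊕ Fin 1) ⊕ Fin 1))
    convert h1.image_comp (Sum.inl : Fin 1 ⊕ Fin 1 → (Fin 1 ⊕ Fin 1) ⊕ Fin 1) using 1
    ext w
    constructor
    · rintro ⟨h₀, h₁, h⟩
      exact ⟨Sum.elim w fun _ => ((⟨_, h₀⟩ * ⟨_, h₁⟩ : G.carrier) : U), ⟨⟨h₀, h₁, by rfl⟩, by exact h⟩, by rfl⟩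
    · rintro ⟨w', ⟨⟨h₀, h₁, h⟩, hX⟩, rfl⟩
      refine ⟨h₀, h₁, ?_⟩
      convert hX using 1
      funext i
      rw [Fin.fin_one_eq_zero i]
      exact h⟩

/-- `φ(x · a)` -/
def translate {A : Set U} (X : L.DefinableSet A (Fin 1)) (a : Fin 1 → U) :
    L.DefinableSet (univ : Set U) (Fin 1) :=
  fiber (G.shift X) a

/-- The pair `(μ, ν)` is `*`-Borel. -/
def IsStarBorel (κ : Cardinal.{w}) (μ ν : KeislerMeasure L U univ 1) : Prop :=
  ∀ X : L.DefinableSet (univ : Set U) (Fin 1), ∃ N, KeislerMeasure.BorelWitness κ μ ν (G.shift X) N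

/-- The value `(μ * ν)(φ(x))` of the convolution. -/
def conv (κ : Cardinal.{w}) (μ ν : KeislerMeasure L U univ 1)
    (X : L.DefinableSet (univ : Set U) (Fin 1)) : ℝ :=
  KeislerMeasure.productValue κ μ ν (G.shift X)

/-- `μ` is `*`-Borel and `μ * μ = μ`. -/
def IsIdempotent (κ : Cardinal.{w}) (μ : KeislerMeasure L U univ 1) : Prop :=
  G.IsStarBorel κ μ μ ∧ ∀ X, G.conv κ μ μ X = μ X

/-- `r = p * q` for an invariant global type `p`: `r` is the type of `a · b`, where
`(a, b) ⊨ p ⊗ q`. That is, `φ(x) ∈ r` if and only if `φ(x · b) ∈ p` for `b ⊨ q|_N`, where `N` is a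
small model that contains the parameters of `φ` and over which `p` is invariant. -/
def IsTypeProduct (κ : Cardinal.{w}) (p q r : TypeSpace L U univ 1) : Prop :=
  (∃ N : L.ElementarySubstructure U, #N < κ ∧ IsInvariantType p N) ∧
  ∀ N : L.ElementarySubstructure U, #N < κ → IsInvariantType p N →
    ∀ (X : L.DefinableSet (N : Set U) (Fin 1)) (b : Fin 1 → U), RealizesRestriction b q N →
      (Contains r (weaken (subset_univ _) X) ↔ Contains p (G.translate X b))

/-- `I` is a (nonempty) left ideal of `(S(μ), *)`. -/
structure IsLeftIdeal (κ : Cardinal.{w}) (μ : KeislerMeasure L U univ 1)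
    (I : Set (TypeSpace L U univ 1)) : Prop where
  nonempty : I.Nonempty
  subset : I ⊆ μ.support
  mul_mem : ∀ p ∈ μ.support, ∀ q ∈ I, ∀ r, G.IsTypeProduct κ p q r → r ∈ I

/-- `μ` is minimal: the support of `μ` is a minimal left ideal of `(S(μ), *)`, i.e. every left
ideal of `(S(μ), *)` is all of `S(μ)`. -/
def IsMinimal (κ : Cardinal.{w}) (μ : KeislerMeasure L U univ 1) : Prop :=
  ∀ I, G.IsLeftIdeal κ μ I → I = μ.support

open Classical in
/-- The function `D_μ^{φ'}` on global types: `p ↦ μ(φ(x · c))` for `c ⊨ p|_N`, where `N` is a small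
model that contains the parameters of `φ` and over which `μ` is definable. (It has the value `0` if
there are no such `N` and `c`, which does not occur for `μ` definable and `U` saturated.) -/
def genericTranslate (κ : Cardinal.{w}) (μ : KeislerMeasure L U univ 1)
    (X : L.DefinableSet (univ : Set U) (Fin 1)) (p : TypeSpace L U univ 1) : ℝ :=
  if h : ∃ c : Fin 1 → U, ∃ N : L.ElementarySubstructure U, #N < κ ∧ μ.IsDefinableOver N ∧
    (N : Set U).Definable L (X : Set (Fin 1 → U)) ∧ RealizesRestriction c p N
  then μ (G.translate X h.choose) else 0

end DefinableGroup

end Keisler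

end

/-! Fix `φ` over a small model `N` over which `μ` is definable, and write `D_φ(p) = μ(φ(x·c))` for
`c ⊨ p|_N` (this is `translateValue`). Definability makes `D_φ` continuous on the compact set
`S(μ)`, and idempotence says that its mean there is `μ(φ)`. Every nonempty relatively open subset of
the support has positive measure, so a continuous function on it that stays on one side of its mean
is constant (`eqOn_of_setIntegral_support_eq`, then `translateValue_eq_of_le` and
`translateValue_eq_of_ge`).

Let `q₀` maximize `D_φ` on `S(μ)`. The maximum points form a left ideal (`isLeftIdeal_setOf_isMax`).
For a maximum point `q` and `c ⊨ q`, put `ψ(x) = φ(x·c)`, so that `μ(ψ)` is the maximum. Each value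
`D_ψ(p')` equals `μ(φ(x·d·c))`, where `d·c` again realizes a type in the support over a small model,
so `D_ψ ≤ μ(ψ)`. The mean argument for `ψ` gives `D_ψ = μ(ψ)` on `S(μ)`, and `D_φ(p*q) = D_ψ(p)`
then shows that `p*q` is a maximum point. By minimality `D_φ` is constant, and the constant is its
mean `μ(φ)`.

For the second claim, `tp(a/G b)` extends to a global type in `S(μ)`, and invariance of `μ` allows
`a` to be replaced by a realization of that type over a larger model. -/

namespace Keisler

/-! ### Types: moving parameters, restriction and realization -/

section Types

variable {L : FirstOrder.Language.{u, v}} {U : Type w} [L.Structure U]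

theorem exists_empty_definable_of_definable {A : Set U} {α : Type*} {S : Set (α → U)}
    (hS : A.Definable L S) :
    ∃ (m : ℕ) (e : Fin m → U) (T : Set (α ⊕ Fin m → U)), (∀ i, e i ∈ A) ∧
      (∅ : Set U).Definable L T ∧ ∀ v, v ∈ S ↔ Sum.elim v e ∈ T := by
  obtain ⟨A₀, hA₀, hd⟩ := definable_iff_finitely_definable.1 hS
  obtain ⟨φ, rfl⟩ := definable_iff_exists_formula_sum.1 hd
  let g : (A₀ : Set U) ≃ Fin A₀.card := A₀.equivFin
  let ψ : L.Formula (α ⊕ Fin A₀.card) := φ.relabel (Sum.elim (Sum.inr ∘ g) Sum.inl)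
  refine ⟨A₀.card, fun i => g.symm i, {w | ψ.Realize w},
    fun i => hA₀ (g.symm i).2, empty_definable_iff.2 ⟨ψ, rfl⟩, fun v => ?_⟩
  simp only [mem_ofPred_eq, ψ, Formula.realize_relabel]
  apply iff_of_eq
  congr 1
  ext (i | i) <;> simp

/-- The finitely many parameters of `R` are moved into the tuple of parameter variables. This is how
invariance or definability over a small model is applied to formulas over a larger one. -/
theorem exists_fiber_eq_fiber_append (A : Set U) {B : Set U} {n : ℕ}
    (R : L.DefinableSet B (Fin 1 ⊕ Fin n)) :
    ∃ (m : ℕ) (e : Fin m → U) (R₀ : L.DefinableSet A (Fin 1 ⊕ Fin (n + m))),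
      (∀ i, e i ∈ B) ∧ ∀ b, fiber R b = fiber R₀ (Fin.append b e) := by
  obtain ⟨m, e, T, he, hT, h⟩ := exists_empty_definable_of_definable R.2
  refine ⟨m, e, ⟨_, (hT.mono (empty_subset A)).preimage_comp (β := Fin 1 ⊕ Fin (n + m))
    (Sum.elim (Sum.map id (Fin.castAdd m)) (Sum.inr ∘ Fin.natAdd n))⟩, he, fun b => ?_⟩
  refine SetLike.ext fun x => (h _).trans (iff_of_eq ?_)
  change _ = ((Sum.elim x (Fin.append b e) ∘ _) ∈ T)
  congr 1
  ext ((i | i) | i) <;> simp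

variable {A B : Set U} {n : ℕ} {κ : Cardinal.{w}}

theorem definable_append {m : ℕ} (hAB : A ⊆ B) {e : Fin m → U} (he : ∀ i, e i ∈ B)
    (X : L.DefinableSet A (Fin (n + m))) :
    B.Definable L {v : Fin n → U | Fin.append v e ∈ X} := by
  refine (X.2.mono hAB).preimage_map (F := fun v : Fin n → U => Fin.append v e) fun i => ?_
  induction i using Fin.addCases with
  | left i =>
    simp only [Fin.append_left]
    exact (definableFun_var (L := L) i).mono (empty_subset _)
  | right i =>
    simp only [Fin.append_right]
    exact definableFun_const L _ (he i)

theorem exists_elementarySubstructure_card_lt (hκ : ℵ₀ < κ)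
    (hL : Cardinal.lift.{w} L.card < Cardinal.lift.{max u v} κ) (hA : #A < κ) :
    ∃ N : L.ElementarySubstructure U, #N < κ ∧ A ⊆ N := by
  -- Downward Löwenheim–Skolem needs a target cardinal at most `#U`; if `U` itself is small, it
  -- serves as the model.
  rcases lt_or_ge #U κ with h | h
  · exact ⟨⊤, (Cardinal.mk_univ (α := U)).trans_lt h, subset_univ _⟩
  · let c : Cardinal.{max u v w} :=
      max (max ℵ₀ (Cardinal.lift.{max u v} #A)) (Cardinal.lift.{w} L.card)
    have hc : c < Cardinal.lift.{max u v} κ := by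
      refine max_lt (max_lt ?_ (Cardinal.lift_lt.2 hA)) hL
      rwa [Cardinal.aleph0_lt_lift]
    obtain ⟨N, hAN, hN⟩ := exists_elementarySubstructure_card_eq L A c
      ((le_max_left _ _).trans (le_max_left _ _))
      (by
        rw [Cardinal.lift_id'.{w, max u v w} c, Cardinal.lift_umax.{w, max u v}]
        exact (le_max_right _ _).trans (le_max_left _ _))
      (by
        rw [Cardinal.lift_id'.{max u v, max u v w} c]
        rw [Cardinal.lift_umax.{max u v, w}]
        exact le_max_right _ _)
      (by
        rw [Cardinal.lift_id'.{w, max u v w} c, Cardinal.lift_umax.{w, max u v}]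
        exact hc.le.trans (Cardinal.lift_le.2 h))
    refine ⟨N, ?_, hAN⟩
    rw [Cardinal.lift_id'.{w, max u v w} c, Cardinal.lift_umax.{w, max u v}] at hN
    rw [← Cardinal.lift_lt.{w, max u v}, hN]
    exact hc

theorem RealizesRestriction.mono {v : Fin n → U} {p : TypeSpace L U univ n} (hAB : A ⊆ B)
    (h : RealizesRestriction v p B) : RealizesRestriction v p A :=
  fun X => h (weaken hAB X)

variable [Nonempty U]

/-- One inclusion suffices because types are complete. -/
theorem typeSpace_ext {p q : TypeSpace L U A n} (h : ∀ X, Contains p X → Contains q X) :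
    p = q := by
  refine SetLike.ext fun σ => ?_
  obtain ⟨φ, rfl⟩ := Formula.equivSentence.surjective σ
  let X : L.DefinableSet A (Fin n) := ⟨{v | φ.Realize v}, φ, rfl⟩
  have key : ∀ r : TypeSpace L U A n, Contains r X ↔ Formula.equivSentence φ ∈ r :=
    fun r => contains_of_realize rfl
  rw [← key, ← key]
  refine ⟨h X, fun hq => ?_⟩
  by_contra hp
  exact contains_compl.1 (h _ (contains_compl.2 hp)) hq

theorem tp_eq_tp_iff {v v' : Fin n → U} :
    tp L A v = tp L A v' ↔ ∀ X : L.DefinableSet A (Fin n), v ∈ X → v' ∈ X := by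
  refine ⟨fun h X hv => contains_tp.1 (h ▸ contains_tp.2 hv), fun h => typeSpace_ext fun X hX => ?_⟩
  exact contains_tp.2 (h X (contains_tp.1 hX))

theorem tp_append_eq {m : ℕ} (hAB : A ⊆ B) {e : Fin m → U} (he : ∀ i, e i ∈ B)
    {v v' : Fin n → U} (h : tp L B v = tp L B v') :
    tp L A (Fin.append v e) = tp L A (Fin.append v' e) :=
  tp_eq_tp_iff.2 fun X hX => tp_eq_tp_iff.1 h ⟨_, definable_append hAB he X⟩ hX

theorem continuous_typeSpace {Y : Type*} [TopologicalSpace Y] {f : Y → TypeSpace L U A n}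
    (h : ∀ X, IsOpen (f ⁻¹' basicClopen X)) : Continuous f := by
  refine CompleteType.isTopologicalBasis_range_typesWith.continuous_iff.2 ?_
  rintro _ ⟨σ, rfl⟩
  obtain ⟨X, hX⟩ := exists_basicClopen_eq (U := U) σ
  rw [← hX]
  exact h X

theorem exists_contains_and_basicClopen_subset {p : TypeSpace L U A n}
    {V : Set (TypeSpace L U A n)} (hV : IsOpen V) (hp : p ∈ V) :
    ∃ X : L.DefinableSet A (Fin n), Contains p X ∧ basicClopen X ⊆ V := by
  obtain ⟨X, h1, h2⟩ := exists_basicClopen_between isCompact_singleton hV (singleton_subset_iff.2 hp)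
  exact ⟨X, h1 rfl, h2⟩

/-- Compactness: the clopen sets `[X]`, for `X` over `A` in `p`, are directed. None is empty, since
an empty `[X]` forces `X` itself to be empty. -/
theorem exists_restrictType (p : TypeSpace L U univ n) (A : Set U) :
    ∃ q : TypeSpace L U A n, ∀ X, Contains q X ↔ Contains p (weaken (subset_univ A) X) := by
  let S := {X : L.DefinableSet A (Fin n) // Contains p (weaken (subset_univ A) X)}
  have hne : Nonempty S := ⟨⟨⊤, contains_top p⟩⟩
  have hdir : Directed (· ⊇ ·) fun X : S => basicClopen X.1 := fun X Y =>
    ⟨⟨X.1 ⊓ Y.1, contains_inf.2 ⟨X.2, Y.2⟩⟩, fun r hr => (contains_inf.1 hr).1,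
      fun r hr => (contains_inf.1 hr).2⟩
  have hnonempty : ∀ X : S, (basicClopen X.1).Nonempty := fun X => by
    by_contra h
    have hbot : weaken (subset_univ A) X.1 ≤ (⊤ : L.DefinableSet univ (Fin n))ᶜ := fun v hv =>
      (h ⟨tp L A v, contains_tp.2 hv⟩).elim
    have h2 : Contains p (weaken (subset_univ A) X.1 ⊓ (⊤ : L.DefinableSet univ (Fin n))ᶜ) := by
      rw [inf_eq_left.2 hbot]
      exact X.2
    exact contains_compl.1 (contains_inf.1 h2).2 (contains_top p)
  obtain ⟨q, hq⟩ := IsCompact.nonempty_iInter_of_directed_nonempty_isCompact_isClosed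
    (fun X : S => basicClopen X.1) hdir hnonempty
    (fun X => (isClopen_basicClopen X.1).isClosed.isCompact)
    (fun X => (isClopen_basicClopen X.1).isClosed)
  rw [mem_iInter] at hq
  refine ⟨q, fun X => ⟨fun hX => ?_, fun hX => hq ⟨X, hX⟩⟩⟩
  by_contra h
  exact contains_compl.1 (hq ⟨Xᶜ, contains_compl.2 h⟩) hX

/-- The restriction `p|_A` of a global type. -/
noncomputable def restrictType (A : Set U) (p : TypeSpace L U univ n) : TypeSpace L U A n :=
  (exists_restrictType p A).choose

theorem contains_restrictType {p : TypeSpace L U univ n} {X : L.DefinableSet A (Fin n)} :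
    Contains (restrictType A p) X ↔ Contains p (weaken (subset_univ A) X) :=
  (exists_restrictType p A).choose_spec X

theorem continuous_restrictType : Continuous (restrictType (L := L) (n := n) A) :=
  continuous_typeSpace fun X => by
    convert (isClopen_basicClopen (weaken (subset_univ A) X)).isOpen using 1
    ext p
    exact contains_restrictType

theorem realizesRestriction_iff {v : Fin n → U} {p : TypeSpace L U univ n} :
    RealizesRestriction v p A ↔ tp L A v = restrictType A p := by
  refine ⟨fun h => typeSpace_ext fun X hX => contains_restrictType.2 ((h X).1 (contains_tp.1 hX)),
    fun h X => ?_⟩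
  rw [← contains_restrictType, ← h, contains_tp]

theorem IsSaturated.exists_realizesRestriction (hU : IsSaturated L U κ) (hA : #A < κ)
    (p : TypeSpace L U univ n) : ∃ v : Fin n → U, RealizesRestriction v p A := by
  obtain ⟨v, hv⟩ := hU A hA n (restrictType A p)
  exact ⟨v, realizesRestriction_iff.2 hv⟩

theorem IsInvariantType.mono {p : TypeSpace L U univ 1} {N N' : L.ElementarySubstructure U}
    (h : IsInvariantType p N) (hN : (N : Set U) ⊆ N') : IsInvariantType p N' := by
  intro n R b b' hb
  obtain ⟨m, e, R₀, he, hR⟩ := exists_fiber_eq_fiber_append (N : Set U) R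
  rw [hR, hR]
  exact h _ R₀ _ _ (tp_append_eq hN he hb)

end Types

end Keisler

namespace Keisler

namespace KeislerMeasure

/-! ### The support of a Keisler measure -/

section Support

variable {L : FirstOrder.Language.{u, v}} {U : Type w} [L.Structure U] [Nonempty U]
  {A B : Set U} {n : ℕ}

theorem isClosed_support (μ : KeislerMeasure L U A n) : IsClosed μ.support := by
  have h : μ.support = ⋂ X : {X // ¬ 0 < μ X}, (basicClopen X.1)ᶜ := by
    ext p
    simp only [support, mem_ofPred_eq, mem_iInter, Subtype.forall, mem_compl_iff, basicClopen]
    exact forall_congr' fun X => not_imp_not.symm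
  rw [h]
  exact isClosed_iInter fun X => (isClopen_basicClopen X.1).isOpen.isClosed_compl

/-- By inner regularity only compact subsets of the complement matter, and each of their points has
a null clopen neighbourhood. -/
theorem borelMeasure_compl_support (μ : KeislerMeasure L U A n) :
    μ.borelMeasure μ.supportᶜ = 0 := by
  rw [μ.isClosed_support.isOpen_compl.measure_eq_iSup_isCompact]
  simp only [ENNReal.iSup_eq_zero]
  refine fun K hK hKc => hKc.measure_zero_of_nhdsWithin fun p hp => ?_
  have hp' : ¬ p ∈ μ.support := hK hp
  simp only [support, mem_ofPred_eq, not_forall] at hp'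
  obtain ⟨X, hX, h0⟩ := hp'
  refine ⟨basicClopen X, mem_nhdsWithin_of_mem_nhds
    ((isClopen_basicClopen X).isOpen.mem_nhds hX), ?_⟩
  rw [borelMeasure_basicClopen, ENNReal.ofReal_eq_zero]
  exact not_lt.1 h0

theorem borelMeasure_basicClopen_inter_support (μ : KeislerMeasure L U A n)
    (X : L.DefinableSet A (Fin n)) :
    μ.borelMeasure (basicClopen X ∩ μ.support) = ENNReal.ofReal (μ X) := by
  rw [measure_inter_conull μ.borelMeasure_compl_support, borelMeasure_basicClopen]

theorem exists_mem_support (μ : KeislerMeasure L U A n) {X : L.DefinableSet A (Fin n)}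
    (hX : 0 < μ X) : ∃ p ∈ μ.support, Contains p X := by
  have h : μ.borelMeasure (basicClopen X ∩ μ.support) ≠ 0 := by
    rw [borelMeasure_basicClopen_inter_support]
    simpa using hX
  obtain ⟨p, h1, h2⟩ := nonempty_of_measure_ne_zero h
  exact ⟨p, h2, h1⟩

theorem support_nonempty (μ : KeislerMeasure L U A n) : μ.support.Nonempty := by
  obtain ⟨p, hp, -⟩ := μ.exists_mem_support (X := ⊤) (by rw [μ.top]; exact one_pos)
  exact ⟨p, hp⟩

theorem restrictType_mem_support {μ : KeislerMeasure L U univ n} {p : TypeSpace L U univ n}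
    (hp : p ∈ μ.support) (A : Set U) : restrictType A p ∈ (μ.restrict A).support :=
  fun _ hX => hp _ (contains_restrictType.1 hX)

/-- The image of the support under restriction is compact, hence closed. A type outside it would
have a clopen neighbourhood `[X]` missing the image; but `X` has positive measure, so it lies in
some type of the global support. -/
theorem exists_restrictType_eq {μ : KeislerMeasure L U univ n} {q : TypeSpace L U A n}
    (hq : q ∈ (μ.restrict A).support) : ∃ p ∈ μ.support, restrictType A p = q := by
  have hclosed : IsClosed (restrictType A '' μ.support) :=
    (μ.isClosed_support.isCompact.image continuous_restrictType).isClosed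
  by_contra h
  obtain ⟨X, hqX, hX⟩ := exists_contains_and_basicClopen_subset hclosed.isOpen_compl
    (show q ∈ (restrictType A '' μ.support)ᶜ from fun ⟨p, hp, hpq⟩ => h ⟨p, hp, hpq⟩)
  obtain ⟨p, hp, hpX⟩ := μ.exists_mem_support (hq X hqX)
  exact hX (contains_restrictType.2 hpX) ⟨p, hp, rfl⟩

/-- The support has measure one, so `r` is the mean of `F` and the nonnegative function `r - F`
vanishes almost everywhere. By continuity a strict inequality at one point would persist on a
neighbourhood, which has positive measure because the point lies in the support. -/
theorem eqOn_of_setIntegral_support_eq (μ : KeislerMeasure L U A n) {F : TypeSpace L U A n → ℝ}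
    (hF : ContinuousOn F μ.support) {r : ℝ} (hr : ∫ q in μ.support, F q ∂μ.borelMeasure = r)
    (hle : ∀ q ∈ μ.support, F q ≤ r) : ∀ q ∈ μ.support, F q = r := by
  have hS : MeasurableSet μ.support := μ.isClosed_support.measurableSet
  have hint : IntegrableOn F μ.support μ.borelMeasure :=
    hF.integrableOn_compact μ.isClosed_support.isCompact
  have hone : μ.borelMeasure.real μ.support = 1 := by
    rw [measureReal_def, (prob_compl_eq_zero_iff hS).1 μ.borelMeasure_compl_support,
      ENNReal.toReal_one]
  have hzero : ∫ q in μ.support, (r - F q) ∂μ.borelMeasure = 0 := by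
    rw [integral_sub (integrable_const r) hint, hr, setIntegral_const, hone, one_smul, sub_self]
  rw [setIntegral_eq_zero_iff_of_nonneg_ae
    ((ae_restrict_iff' hS).2 (ae_of_all _ fun q hq => sub_nonneg.2 (hle q hq)))
    ((integrable_const r).sub hint)] at hzero
  by_contra! h
  obtain ⟨q, hq, hne⟩ := h
  obtain ⟨V, hV, hVF⟩ := continuousOn_iff'.1 hF (Iio r) isOpen_Iio
  have hqV : q ∈ V := (hVF.subset ⟨lt_of_le_of_ne (hle q hq) hne, hq⟩).1
  obtain ⟨X, hqX, hXV⟩ := exists_contains_and_basicClopen_subset hV hqV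
  have hnull : μ.borelMeasure (basicClopen X ∩ μ.support) = 0 := by
    refine measure_mono_null (fun p hp => ?_) ((ae_restrict_iff' hS).1 hzero)
    have hpF : F p < r := (hVF.superset ⟨hXV hp.1, hp.2⟩).1
    exact fun h0 => (sub_pos.2 hpF).ne' (h0 hp.2)
  rw [borelMeasure_basicClopen_inter_support, ENNReal.ofReal_eq_zero] at hnull
  exact (hq X hqX).not_ge hnull

end Support

/-! ### Definable measures and the product integral -/

section Definable

variable {L : FirstOrder.Language.{u, v}} {U : Type w} [L.Structure U] [Nonempty U]
  {κ : Cardinal.{w}} {μ ν : KeislerMeasure L U univ 1} {N N' : L.ElementarySubstructure U} {n : ℕ}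

theorem IsInvariantOver.fiber_eq {B : Set U} (h : μ.IsInvariantOver N) (hN : (N : Set U) ⊆ B)
    (R : L.DefinableSet B (Fin 1 ⊕ Fin n)) {b b' : Fin n → U} (hb : tp L B b = tp L B b') :
    μ (fiber R b) = μ (fiber R b') := by
  obtain ⟨m, e, R₀, he, hR⟩ := exists_fiber_eq_fiber_append (N : Set U) R
  rw [hR, hR]
  exact h _ R₀ _ _ (tp_append_eq hN he hb)

theorem fiberMap_tp {A B : Set U} {R : L.DefinableSet B (Fin 1 ⊕ Fin n)} {b : Fin n → U}
    (h : ∀ b', tp L A b' = tp L A b → μ (fiber R b') = μ (fiber R b)) :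
    μ.fiberMap A R (tp L A b) = μ (fiber R b) := by
  have hex : ∃ b', tp L A b' = tp L A b := ⟨b, rfl⟩
  rw [fiberMap, dif_pos hex]
  exact h _ hex.choose_spec

theorem IsInvariantOver.fiberMap_tp (h : μ.IsInvariantOver N)
    (R : L.DefinableSet (N : Set U) (Fin 1 ⊕ Fin n)) (b : Fin n → U) :
    μ.fiberMap (N : Set U) R (tp L (N : Set U) b) = μ (fiber R b) :=
  KeislerMeasure.fiberMap_tp fun _ hb => h _ R _ _ hb

theorem IsDefinableOver.mono (hU : IsSaturated L U κ) (h : μ.IsDefinableOver N)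
    (hN : (N : Set U) ⊆ N') (hN' : #N' < κ) : μ.IsDefinableOver N' := by
  have hinv : μ.IsInvariantOver N' := fun n R b b' hb => h.1.fiber_eq hN R hb
  refine ⟨hinv, fun n R => ?_⟩
  obtain ⟨m, e, R₀, he, hR⟩ := exists_fiber_eq_fiber_append (N : Set U) R
  -- The realizations `c q` are arbitrary, but `tp(c q, e / N)` depends only on `q`. The fibre map
  -- over `N'` is this continuous map followed by a fibre map over `N`.
  choose c hc using hU (N' : Set U) hN' n
  have hcont : Continuous fun q => tp L (N : Set U) (Fin.append (c q) e) := by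
    refine continuous_typeSpace fun X => ?_
    let Y : L.DefinableSet (N' : Set U) (Fin n) := ⟨_, definable_append hN he X⟩
    convert (isClopen_basicClopen Y).isOpen using 1
    ext q
    have hY : Contains q Y ↔ c q ∈ Y := by rw [← contains_tp (A := (N' : Set U)), hc q]
    exact contains_tp.trans hY.symm
  convert (h.2 _ R₀).comp hcont using 1
  ext q
  rw [Function.comp_apply, h.1.fiberMap_tp, ← hR, ← hinv.fiberMap_tp, hc]

/-- The model inside `productValue` is an arbitrary choice, over which `μ` need not be definable.
Its integrand is nevertheless continuous on the support: it pulls back along restriction to `f`, and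
restriction is a closed map on the compact global support. -/
theorem exists_continuousOn_productValue_eq (hU : IsSaturated L U κ) (hκ : ℵ₀ < κ)
    {R : L.DefinableSet (univ : Set U) (Fin 1 ⊕ Fin 1)} (hR : ∃ N, BorelWitness κ μ ν R N)
    {B : Set U} (hB : #B < κ) {f : TypeSpace L U univ 1 → ℝ} (hf : Continuous f)
    (hfR : ∀ p ∈ ν.support, ∀ c, RealizesRestriction c p B → μ (fiber R c) = f p) :
    ∃ (A : Set U) (F : TypeSpace L U A 1 → ℝ), ContinuousOn F (ν.restrict A).support ∧
      (∀ p ∈ ν.support, F (restrictType A p) = f p) ∧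
      ∫ q in (ν.restrict A).support, F q ∂(ν.restrict A).borelMeasure =
        productValue κ μ ν R := by
  have hF : ∀ p ∈ ν.support,
      μ.fiberMap (hR.choose : Set U) R (restrictType (hR.choose : Set U) p) = f p := by
    intro p hp
    -- A realization over both the chosen model and `B` computes the integrand and `f` at once.
    obtain ⟨c, hc⟩ := hU.exists_realizesRestriction
      ((Cardinal.mk_union_le (hR.choose : Set U) B).trans_lt
        (Cardinal.add_lt_of_lt hκ.le hR.choose_spec.small hB)) p
    have hcN := realizesRestriction_iff.1 (RealizesRestriction.mono subset_union_left hc)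
    rw [← hfR p hp c (RealizesRestriction.mono subset_union_right hc), ← hcN]
    refine fiberMap_tp fun b' hb' => ?_
    exact hR.choose_spec.wellDefined _ (restrictType_mem_support hp _) _ _ (hb'.trans hcN) hcN
  refine ⟨hR.choose, μ.fiberMap (hR.choose : Set U) R, ?_, hF, ?_⟩
  · rw [continuousOn_iff_isClosed]
    intro t ht
    refine ⟨restrictType (hR.choose : Set U) '' (ν.support ∩ f ⁻¹' t),
      ((ν.isClosed_support.inter (ht.preimage hf)).isCompact.image
        continuous_restrictType).isClosed, ?_⟩
    ext q
    constructor
    · rintro ⟨hqt, hq⟩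
      obtain ⟨p, hp, rfl⟩ := exists_restrictType_eq hq
      refine ⟨⟨p, ⟨hp, ?_⟩, rfl⟩, hq⟩
      rwa [mem_preimage, hF p hp] at hqt
    · rintro ⟨⟨p, ⟨hp, hpt⟩, rfl⟩, hq⟩
      refine ⟨?_, hq⟩
      rwa [mem_preimage, hF p hp]
  · rw [productValue, dif_pos hR]

theorem eq_productValue_of_le (hU : IsSaturated L U κ) (hκ : ℵ₀ < κ)
    {R : L.DefinableSet (univ : Set U) (Fin 1 ⊕ Fin 1)} (hR : ∃ N, BorelWitness κ μ ν R N)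
    {B : Set U} (hB : #B < κ) {f : TypeSpace L U univ 1 → ℝ} (hf : Continuous f)
    (hfR : ∀ p ∈ ν.support, ∀ c, RealizesRestriction c p B → μ (fiber R c) = f p)
    (hle : ∀ p ∈ ν.support, f p ≤ productValue κ μ ν R) :
    ∀ p ∈ ν.support, f p = productValue κ μ ν R := by
  obtain ⟨A, F, hFc, hF, hint⟩ := exists_continuousOn_productValue_eq hU hκ hR hB hf hfR
  intro p hp
  rw [← hF p hp]
  refine eqOn_of_setIntegral_support_eq _ hFc hint (fun q hq => ?_) _
    (restrictType_mem_support hp A)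
  obtain ⟨p, hp, rfl⟩ := exists_restrictType_eq hq
  rw [hF p hp]
  exact hle p hp

theorem eq_productValue_of_ge (hU : IsSaturated L U κ) (hκ : ℵ₀ < κ)
    {R : L.DefinableSet (univ : Set U) (Fin 1 ⊕ Fin 1)} (hR : ∃ N, BorelWitness κ μ ν R N)
    {B : Set U} (hB : #B < κ) {f : TypeSpace L U univ 1 → ℝ} (hf : Continuous f)
    (hfR : ∀ p ∈ ν.support, ∀ c, RealizesRestriction c p B → μ (fiber R c) = f p)
    (hge : ∀ p ∈ ν.support, productValue κ μ ν R ≤ f p) :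
    ∀ p ∈ ν.support, f p = productValue κ μ ν R := by
  obtain ⟨A, F, hFc, hF, hint⟩ := exists_continuousOn_productValue_eq hU hκ hR hB hf hfR
  intro p hp
  rw [← hF p hp]
  refine neg_injective (eqOn_of_setIntegral_support_eq _ (F := fun q => -F q) hFc.neg
    (by rw [integral_neg, hint]) (fun q hq => ?_) _ (restrictType_mem_support hp A))
  obtain ⟨p, hp, rfl⟩ := exists_restrictType_eq hq
  rw [hF p hp]
  exact neg_le_neg (hge p hp)

end Definable

end KeislerMeasure

end Keisler

namespace Keisler

/-! ### Translates, the semigroup of the support, and minimality -/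

namespace DefinableGroup

variable {L : FirstOrder.Language.{u, v}} {U : Type w} [L.Structure U]

theorem mem_translate (G : DefinableGroup L U) {A : Set U} {X : L.DefinableSet A (Fin 1)}
    {a x : Fin 1 → U} :
    x ∈ G.translate X a ↔ ∃ (hx : x 0 ∈ G.carrier) (ha : a 0 ∈ G.carrier),
      (fun _ => ((⟨x 0, hx⟩ * ⟨a 0, ha⟩ : G.carrier) : U)) ∈ X :=
  Iff.rfl

theorem translate_translate (G : DefinableGroup L U) {A : Set U} (X : L.DefinableSet A (Fin 1))
    {c d : Fin 1 → U} (hc : c 0 ∈ G.carrier) (hd : d 0 ∈ G.carrier) :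
    G.translate (G.translate X c) d =
      G.translate X fun _ => ((⟨d 0, hd⟩ * ⟨c 0, hc⟩ : G.carrier) : U) := by
  refine SetLike.ext fun x => ?_
  simp only [mem_translate, Subtype.coe_prop, hc, hd, exists_true_left, Subtype.coe_eta, mul_assoc]

theorem definable_translate (G : DefinableGroup L U) {A B : Set U} (hAB : A ⊆ B)
    (X : L.DefinableSet A (Fin 1)) {c : Fin 1 → U} (hc : c 0 ∈ B) :
    B.Definable L (G.translate X c : Set (Fin 1 → U)) := by
  refine ((G.shift X).2.mono hAB).preimage_map (F := fun x => Sum.elim x c) ?_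
  rintro (i | j)
  · exact (definableFun_var (L := L) i).mono (empty_subset _)
  · rw [Fin.fin_one_eq_zero j]
    exact definableFun_const L _ hc

variable [Nonempty U] {κ : Cardinal.{w}} {μ : KeislerMeasure L U univ 1}

/-- The complement of the carrier is null, so no type in the support contains it. -/
theorem mem_carrier_of_realizesRestriction {G : DefinableGroup L U} (hμG : μ G.carrierSet = 1)
    {p : TypeSpace L U univ 1} (hp : p ∈ μ.support) {B : Set U} {c : Fin 1 → U}
    (hc : RealizesRestriction c p B) : c 0 ∈ G.carrier := by
  let C : L.DefinableSet B (Fin 1) := ⟨{v | v 0 ∈ G.carrier}, G.definable_carrier.mono (empty_subset _)⟩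
  refine (hc C).2 ?_
  by_contra h
  have h1 := hp _ (contains_compl.2 h)
  have h2 := μ.sup_of_disjoint _ _ (disjoint_compl_right (a := G.carrierSet))
  rw [sup_compl_eq_top, μ.top, hμG] at h2
  exact h1.ne (by linarith : (0 : ℝ) = μ G.carrierSetᶜ)

/-- The function `D_μ^{φ'}`, computed with a fixed model `N` over which `φ` is defined. -/
noncomputable def translateValue (G : DefinableGroup L U) (μ : KeislerMeasure L U univ 1)
    (N : L.ElementarySubstructure U) (X : L.DefinableSet (N : Set U) (Fin 1))
    (p : TypeSpace L U univ 1) : ℝ :=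
  μ.fiberMap (N : Set U) (G.shift X) (restrictType (N : Set U) p)

theorem continuous_translateValue (G : DefinableGroup L U) {N : L.ElementarySubstructure U}
    (h : μ.IsDefinableOver N) (X : L.DefinableSet (N : Set U) (Fin 1)) :
    Continuous (G.translateValue μ N X) :=
  (h.2 _ _).comp continuous_restrictType

theorem apply_translate_eq_translateValue (G : DefinableGroup L U)
    {N : L.ElementarySubstructure U} (h : μ.IsInvariantOver N)
    (X : L.DefinableSet (N : Set U) (Fin 1)) {c : Fin 1 → U} {p : TypeSpace L U univ 1}
    (hc : RealizesRestriction c p N) : μ (G.translate X c) = G.translateValue μ N X p := by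
  rw [translateValue, ← realizesRestriction_iff.1 hc, h.fiberMap_tp]
  rfl

/-- Idempotence identifies `μ(X)` with the mean of `translateValue` over the support. -/
theorem translateValue_eq_of_le {G : DefinableGroup L U} (hU : IsSaturated L U κ) (hκ : ℵ₀ < κ)
    (hidem : G.IsIdempotent κ μ) {N : L.ElementarySubstructure U} (hNκ : #N < κ)
    (hN : μ.IsDefinableOver N) (X : L.DefinableSet (N : Set U) (Fin 1))
    (h : ∀ p ∈ μ.support, G.translateValue μ N X p ≤ μ (weaken (subset_univ _) X)) :
    ∀ p ∈ μ.support, G.translateValue μ N X p = μ (weaken (subset_univ _) X) := by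
  have hX := hidem.2 (weaken (subset_univ _) X)
  rw [conv] at hX
  rw [← hX] at h ⊢
  exact KeislerMeasure.eq_productValue_of_le hU hκ (hidem.1 _) hNκ
    (G.continuous_translateValue hN X)
    (fun p _ c hc => G.apply_translate_eq_translateValue hN.1 X hc) h

theorem translateValue_eq_of_ge {G : DefinableGroup L U} (hU : IsSaturated L U κ) (hκ : ℵ₀ < κ)
    (hidem : G.IsIdempotent κ μ) {N : L.ElementarySubstructure U} (hNκ : #N < κ)
    (hN : μ.IsDefinableOver N) (X : L.DefinableSet (N : Set U) (Fin 1))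
    (h : ∀ p ∈ μ.support, μ (weaken (subset_univ _) X) ≤ G.translateValue μ N X p) :
    ∀ p ∈ μ.support, G.translateValue μ N X p = μ (weaken (subset_univ _) X) := by
  have hX := hidem.2 (weaken (subset_univ _) X)
  rw [conv] at hX
  rw [← hX] at h ⊢
  exact KeislerMeasure.eq_productValue_of_ge hU hκ (hidem.1 _) hNκ
    (G.continuous_translateValue hN X)
    (fun p _ c hc => G.apply_translate_eq_translateValue hN.1 X hc) h

/-- A set of measure zero has null translates by realizations of types in the support. -/
theorem apply_translate_eq_zero {G : DefinableGroup L U} (hU : IsSaturated L U κ) (hκ : ℵ₀ < κ)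
    (hidem : G.IsIdempotent κ μ) {N : L.ElementarySubstructure U} (hNκ : #N < κ)
    (hN : μ.IsDefinableOver N) {X : L.DefinableSet (N : Set U) (Fin 1)}
    (hX : μ (weaken (subset_univ _) X) = 0) {q : TypeSpace L U univ 1} (hq : q ∈ μ.support)
    {c : Fin 1 → U} (hc : RealizesRestriction c q N) : μ (G.translate X c) = 0 := by
  -- The translate values are nonnegative with mean `μ(X) = 0`, so they vanish on the support.
  rw [G.apply_translate_eq_translateValue hN.1 X hc,
    translateValue_eq_of_ge hU hκ hidem hNκ hN X (fun p hp => ?_) q hq, hX]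
  obtain ⟨d, hd⟩ := hU.exists_realizesRestriction hNκ p
  rw [hX, ← G.apply_translate_eq_translateValue hN.1 X hd]
  exact μ.nonneg _

theorem exists_model_of_isDefinable (hU : IsSaturated L U κ) (hκ : ℵ₀ < κ)
    (hL : Cardinal.lift.{w} L.card < Cardinal.lift.{max u v} κ) (hdef : μ.IsDefinable κ)
    {A : Set U} (hA : #A < κ) (X : L.DefinableSet (univ : Set U) (Fin 1)) :
    ∃ N : L.ElementarySubstructure U, #N < κ ∧ A ⊆ N ∧ μ.IsDefinableOver N ∧
      ∃ Y : L.DefinableSet (N : Set U) (Fin 1), weaken (subset_univ _) Y = X := by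
  obtain ⟨N₀, hN₀, hμ⟩ := hdef
  obtain ⟨A₀, -, hX⟩ := definable_iff_finitely_definable.1 X.2
  have hcard : #((N₀ ∪ A ∪ A₀ : Set U)) < κ :=
    (Cardinal.mk_union_le _ _).trans_lt <| Cardinal.add_lt_of_lt hκ.le
      ((Cardinal.mk_union_le _ _).trans_lt (Cardinal.add_lt_of_lt hκ.le hN₀ hA))
      ((Cardinal.lt_aleph0_of_finite A₀).trans hκ)
  obtain ⟨N, hNκ, hN⟩ := exists_elementarySubstructure_card_lt hκ hL hcard
  have h₁ := (subset_union_left.trans subset_union_left).trans hN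
  exact ⟨N, hNκ, (subset_union_right.trans subset_union_left).trans hN, hμ.mono hU h₁ hNκ,
    ⟨X, hX.mono (subset_union_right.trans hN)⟩, rfl⟩

/-- The support of an idempotent measure is closed under products of types. -/
theorem mem_support_of_isTypeProduct {G : DefinableGroup L U} (hU : IsSaturated L U κ)
    (hκ : ℵ₀ < κ) (hL : Cardinal.lift.{w} L.card < Cardinal.lift.{max u v} κ)
    (hdef : μ.IsDefinable κ) (hidem : G.IsIdempotent κ μ) {p q r : TypeSpace L U univ 1}
    (hp : p ∈ μ.support) (hq : q ∈ μ.support) (h : G.IsTypeProduct κ p q r) : r ∈ μ.support := by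
  intro X hX
  obtain ⟨⟨N₁, hN₁κ, hN₁⟩, hprod⟩ := h
  obtain ⟨N, hNκ, hN₁N, hN, Y, rfl⟩ := exists_model_of_isDefinable hU hκ hL hdef hN₁κ X
  refine (μ.nonneg _).lt_of_ne' fun h0 => ?_
  obtain ⟨c, hc⟩ := hU.exists_realizesRestriction hNκ q
  -- The translate of a null `X` by `c` would be null, yet it belongs to `p`, which lies in the
  -- support.
  refine (hp _ ((hprod N hNκ (hN₁.mono hN₁N) Y c hc).1 hX)).ne' ?_
  exact apply_translate_eq_zero hU hκ hidem hNκ hN h0 hq hc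

/-- If `c ⊨ q|_N` and `d ⊨ p|_B` with `p`, `q` in the support and `B ⊇ N ∪ {c}`, then `d · c`
realizes the restriction to `N` of a type in the support. -/
theorem exists_realizesRestriction_mul {G : DefinableGroup L U} (hU : IsSaturated L U κ)
    (hκ : ℵ₀ < κ) (hidem : G.IsIdempotent κ μ) {N : L.ElementarySubstructure U} (hNκ : #N < κ)
    (hN : μ.IsDefinableOver N) {p q : TypeSpace L U univ 1} (hp : p ∈ μ.support)
    (hq : q ∈ μ.support) {B : Set U} (hNB : (N : Set U) ⊆ B) {c d : Fin 1 → U}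
    (hc : RealizesRestriction c q N) (hcB : c 0 ∈ B) (hd : RealizesRestriction d p B)
    (hcG : c 0 ∈ G.carrier) (hdG : d 0 ∈ G.carrier) :
    ∃ r ∈ μ.support,
      RealizesRestriction (fun _ => ((⟨d 0, hdG⟩ * ⟨c 0, hcG⟩ : G.carrier) : U)) r N := by
  have hmem : tp L (N : Set U) (fun _ : Fin 1 => ((⟨d 0, hdG⟩ * ⟨c 0, hcG⟩ : G.carrier) : U)) ∈
      (μ.restrict (N : Set U)).support := by
    intro Z hZ
    refine ((μ.restrict (N : Set U)).nonneg _).lt_of_ne' fun h0 => ?_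
    -- With `c` in `B`, the condition `Z(x·c)` is over `B`, so it holds of `d` exactly when it
    -- belongs to `p`.
    let W : L.DefinableSet B (Fin 1) := ⟨_, G.definable_translate hNB Z hcB⟩
    have hdW : d ∈ W := G.mem_translate.2 ⟨hdG, hcG, contains_tp.1 hZ⟩
    exact (hp _ ((hd W).1 hdW)).ne' (apply_translate_eq_zero hU hκ hidem hNκ hN h0 hq hc)
  obtain ⟨r, hr, hrN⟩ := KeislerMeasure.exists_restrictType_eq hmem
  exact ⟨r, hr, realizesRestriction_iff.2 hrN.symm⟩

theorem realizesRestriction_mul_of_isTypeProduct {G : DefinableGroup L U}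
    {N : L.ElementarySubstructure U} (hNκ : #N < κ) {p q r : TypeSpace L U univ 1}
    (h : G.IsTypeProduct κ p q r) (hpN : IsInvariantType p N) {B : Set U}
    (hNB : (N : Set U) ⊆ B) {c d : Fin 1 → U} (hc : RealizesRestriction c q N) (hcB : c 0 ∈ B)
    (hd : RealizesRestriction d p B) (hcG : c 0 ∈ G.carrier) (hdG : d 0 ∈ G.carrier) :
    RealizesRestriction (fun _ => ((⟨d 0, hdG⟩ * ⟨c 0, hcG⟩ : G.carrier) : U)) r N := by
  intro Z
  let W : L.DefinableSet B (Fin 1) := ⟨_, G.definable_translate hNB Z hcB⟩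
  rw [h.2 N hNκ hpN Z c hc]
  refine Iff.trans ⟨fun hZ => ?_, fun hW => ?_⟩ (hd W)
  · exact G.mem_translate.2 ⟨hdG, hcG, hZ⟩
  · obtain ⟨_, _, hZ⟩ := G.mem_translate.1 hW
    exact hZ

/-- For a maximum point `q` and `c ⊨ q`, the translate `X(x·c)` attains the maximal measure. Its own
translate values are values for products `d·c`, hence at most that measure, and the mean argument
makes them all equal to it. -/
theorem isLeftIdeal_setOf_isMax {G : DefinableGroup L U} (hU : IsSaturated L U κ)
    (hκ : ℵ₀ < κ) (hL : Cardinal.lift.{w} L.card < Cardinal.lift.{max u v} κ)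
    (hμG : μ G.carrierSet = 1) (hidem : G.IsIdempotent κ μ) {N : L.ElementarySubstructure U}
    (hNκ : #N < κ) (hN : μ.IsDefinableOver N) (X : L.DefinableSet (N : Set U) (Fin 1))
    {q₀ : TypeSpace L U univ 1} (hq₀ : q₀ ∈ μ.support)
    (hmax : ∀ p ∈ μ.support, G.translateValue μ N X p ≤ G.translateValue μ N X q₀) :
    G.IsLeftIdeal κ μ
      {p | p ∈ μ.support ∧ G.translateValue μ N X p = G.translateValue μ N X q₀} := by
  refine ⟨⟨q₀, hq₀, rfl⟩, fun p hp => hp.1, fun p hp q hq r hr => ?_⟩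
  have hdef : μ.IsDefinable κ := ⟨N, hNκ, hN⟩
  refine ⟨mem_support_of_isTypeProduct hU hκ hL hdef hidem hp hq.1 hr, ?_⟩
  obtain ⟨N₁, hN₁κ, hN₁⟩ := hr.1
  obtain ⟨N', hN'κ, hNN', hN', -⟩ := exists_model_of_isDefinable hU hκ hL hdef
    ((Cardinal.mk_union_le (N : Set U) N₁).trans_lt (Cardinal.add_lt_of_lt hκ.le hNκ hN₁κ)) ⊤
  rw [union_subset_iff] at hNN'
  obtain ⟨c, hc⟩ := hU.exists_realizesRestriction hN'κ q
  have hcG := mem_carrier_of_realizesRestriction hμG hq.1 hc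
  -- `M` must contain `c`, so that `X(x·c)` becomes a set `Y` over `M` and `d ⊨ p|_M` is generic
  -- over `c`.
  obtain ⟨M, hMκ, hN'M, hM, Y, hY⟩ := exists_model_of_isDefinable hU hκ hL hdef
    ((Cardinal.mk_union_le (N' : Set U) {c 0}).trans_lt
      (Cardinal.add_lt_of_lt hκ.le hN'κ (by simpa using! Cardinal.one_lt_aleph0.trans hκ)))
    (G.translate X c)
  rw [union_subset_iff, singleton_subset_iff] at hN'M
  have hμY : μ (weaken (subset_univ _) Y) = G.translateValue μ N X q₀ := by
    rw [hY, G.apply_translate_eq_translateValue hN.1 X (RealizesRestriction.mono hNN'.1 hc), hq.2]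
  have hmul : ∀ d : Fin 1 → U, ∀ hdG : d 0 ∈ G.carrier, ∀ p', RealizesRestriction d p' M →
      G.translateValue μ M Y p' =
        μ (G.translate X fun _ => ((⟨d 0, hdG⟩ * ⟨c 0, hcG⟩ : G.carrier) : U)) := by
    intro d hdG p' hd
    rw [← G.apply_translate_eq_translateValue hM.1 Y hd, ← G.translate_translate X hcG hdG, ← hY]
    rfl
  have hle : ∀ p' ∈ μ.support, G.translateValue μ M Y p' ≤ μ (weaken (subset_univ _) Y) := by
    intro p' hp'
    obtain ⟨d, hd⟩ := hU.exists_realizesRestriction hMκ p'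
    have hdG := mem_carrier_of_realizesRestriction hμG hp' hd
    obtain ⟨r', hr', hdc⟩ := exists_realizesRestriction_mul hU hκ hidem hN'κ hN' hp' hq.1
      hN'M.1 hc hN'M.2 hd hcG hdG
    rw [hmul d hdG p' hd, hμY, G.apply_translate_eq_translateValue hN.1 X
      (RealizesRestriction.mono hNN'.1 hdc)]
    exact hmax r' hr'
  obtain ⟨d, hd⟩ := hU.exists_realizesRestriction hMκ p
  have hdG := mem_carrier_of_realizesRestriction hμG hp hd
  have hdc := realizesRestriction_mul_of_isTypeProduct hN'κ hr (hN₁.mono hNN'.2) hN'M.1 hc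
    hN'M.2 hd hcG hdG
  rw [← G.apply_translate_eq_translateValue hN.1 X (RealizesRestriction.mono hNN'.1 hdc),
    ← hmul d hdG p hd, translateValue_eq_of_le hU hκ hidem hMκ hM Y hle p hp, hμY]

/-- For minimal `μ`, the function `D_μ^{φ'}` is constant on the support. -/
theorem translateValue_eq {G : DefinableGroup L U} (hU : IsSaturated L U κ)
    (hκ : ℵ₀ < κ) (hL : Cardinal.lift.{w} L.card < Cardinal.lift.{max u v} κ)
    (hμG : μ G.carrierSet = 1) (hidem : G.IsIdempotent κ μ)
    (hmin : G.IsMinimal κ μ) {N : L.ElementarySubstructure U} (hNκ : #N < κ)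
    (hN : μ.IsDefinableOver N) (X : L.DefinableSet (N : Set U) (Fin 1))
    {p : TypeSpace L U univ 1} (hp : p ∈ μ.support) :
    G.translateValue μ N X p = μ (weaken (subset_univ _) X) := by
  obtain ⟨q₀, hq₀, hmax⟩ := μ.isClosed_support.isCompact.exists_isMaxOn μ.support_nonempty
    (G.continuous_translateValue hN X).continuousOn
  have hconst : ∀ p ∈ μ.support, G.translateValue μ N X p = G.translateValue μ N X q₀ := by
    intro p hp
    rw [← hmin _ (isLeftIdeal_setOf_isMax hU hκ hL hμG hidem hNκ hN X hq₀ hmax)] at hp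
    exact hp.2
  -- A constant lies on one side of the mean, and in either case the mean argument gives equality.
  rcases le_total (G.translateValue μ N X q₀) (μ (weaken (subset_univ _) X)) with h | h
  · exact translateValue_eq_of_le hU hκ hidem hNκ hN X
      (fun p hp => (hconst p hp).trans_le h) p hp
  · exact translateValue_eq_of_ge hU hκ hidem hNκ hN X
      (fun p hp => h.trans_eq (hconst p hp).symm) p hp

/-- For minimal `μ`, translating by an element whose type over a sufficiently large set lies in
the support does not change the measure. -/
theorem apply_translate_eq {G : DefinableGroup L U} (hU : IsSaturated L U κ)
    (hκ : ℵ₀ < κ) (hL : Cardinal.lift.{w} L.card < Cardinal.lift.{max u v} κ)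
    (hμG : μ G.carrierSet = 1) (hidem : G.IsIdempotent κ μ)
    (hmin : G.IsMinimal κ μ) {N : L.ElementarySubstructure U} (hNκ : #N < κ)
    (hN : μ.IsDefinableOver N) {B : Set U} (hNB : (N : Set U) ⊆ B) (hB : #B < κ)
    (X : L.DefinableSet B (Fin 1)) {a : Fin 1 → U}
    (ha : tp L B a ∈ (μ.restrict B).support) :
    μ (G.translate X a) = μ (weaken (subset_univ _) X) := by
  obtain ⟨p, hp, hpa⟩ := KeislerMeasure.exists_restrictType_eq ha
  obtain ⟨M, hMκ, hBM, hM, Y, hY⟩ := exists_model_of_isDefinable hU hκ hL ⟨N, hNκ, hN⟩ hB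
    (weaken (subset_univ _) X)
  -- `a` need not realize `p` over `M`. It has the same type over `B` as `c`, and `μ` is invariant
  -- over `N ⊆ B`.
  obtain ⟨c, hc⟩ := hU.exists_realizesRestriction hMκ p
  have hac : tp L B a = tp L B c :=
    hpa.symm.trans (realizesRestriction_iff.1 (RealizesRestriction.mono hBM hc)).symm
  have hXY : G.translate Y c = G.translate X c := by
    change G.translate (weaken (subset_univ _) Y) c = _
    rw [hY]
    rfl
  calc μ (G.translate X a) = μ (G.translate X c) := hN.1.fiber_eq hNB (G.shift X) hac
    _ = G.translateValue μ M Y p := by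
      rw [← hXY, G.apply_translate_eq_translateValue hM.1 Y hc]
    _ = μ (weaken (subset_univ _) X) := by
      rw [translateValue_eq hU hκ hL hμG hidem hmin hMκ hM Y hp, hY]

end DefinableGroup

end Keisler

open Keisler in
theorem mainTheorem8 {L : FirstOrder.Language.{u, v}} {U : Type w} [L.Structure U] [Nonempty U]
    (κ : Cardinal.{w}) (hκ : ℵ₀ < κ)
    (hL : Cardinal.lift.{w} L.card < Cardinal.lift.{max u v} κ)
    (hU : IsSaturated L U κ)
    (G : DefinableGroup L U)
    (μ : KeislerMeasure L U univ 1) (hμG : μ G.carrierSet = 1)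
    (hdef : μ.IsDefinable κ)
    (hinv : μ.IsInvariantlySupported κ)
    (hidem : G.IsIdempotent κ μ)
    (hmin : G.IsMinimal κ μ) :
    (∀ (X : L.DefinableSet (univ : Set U) (Fin 1)), ∀ p ∈ μ.support,
      G.genericTranslate κ μ X p = μ X) ∧
    (∀ G₀ : L.ElementarySubstructure U, #G₀ < κ → μ.IsDefinableOver G₀ →
      ∀ (m : ℕ) (b : Fin m → U) (X : L.DefinableSet ((G₀ : Set U) ∪ range b) (Fin 1)),
      ∀ a ∈ G.carrier,
        tp L ((G₀ : Set U) ∪ range b) (fun _ : Fin 1 => a) ∈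
          (μ.restrict ((G₀ : Set U) ∪ range b)).support →
        μ (weaken (subset_univ _) X) = μ (G.translate X fun _ => a)) := by
  refine ⟨fun X p hp => ?_, fun G₀ hG₀ hμ m b X a _ ha => ?_⟩
  · obtain ⟨N₀, hN₀κ, -, hN₀, Y₀, hY₀⟩ := DefinableGroup.exists_model_of_isDefinable hU hκ hL hdef
      (A := ∅) (by simpa using! Cardinal.aleph0_pos.trans hκ) X
    obtain ⟨c₀, hc₀⟩ := hU.exists_realizesRestriction hN₀κ p
    -- `N₀` and `c₀` only rule out the default value `0`; the computation uses the model and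
    -- realization chosen in `genericTranslate`.
    have hex : ∃ c : Fin 1 → U, ∃ N : L.ElementarySubstructure U, #N < κ ∧ μ.IsDefinableOver N ∧
        (N : Set U).Definable L (X : Set (Fin 1 → U)) ∧ RealizesRestriction c p N :=
      ⟨c₀, N₀, hN₀κ, hN₀, hY₀ ▸ Y₀.2, hc₀⟩
    rw [DefinableGroup.genericTranslate, dif_pos hex]
    obtain ⟨N, hNκ, hN, hX, hc⟩ := hex.choose_spec
    let Y : L.DefinableSet (N : Set U) (Fin 1) := ⟨X, hX⟩
    exact (G.apply_translate_eq_translateValue hN.1 Y hc).trans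
      (DefinableGroup.translateValue_eq hU hκ hL hμG hidem hmin hNκ hN Y hp)
  · have hB : #((G₀ : Set U) ∪ range b : Set U) < κ :=
      (Cardinal.mk_union_le _ _).trans_lt (Cardinal.add_lt_of_lt hκ.le hG₀
        ((Cardinal.lt_aleph0_of_finite _).trans hκ))
    exact (DefinableGroup.apply_translate_eq hU hκ hL hμG hidem hmin hG₀ hμ subset_union_left hB
      X ha).symm
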